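/- Let $V$ be a real vector space of finite dimension $m\ge 4$. Let $S^2(V^*)$ be the space of symmetric bilinear forms on $V$, and regard $S^2(V^*)\otimes V$ as the space of symmetric bilinear maps $V\times V\to V$ and $\otimes^2V^*\otimes\operatorname{End}(V)$ as the space of bilinear maps $V\times V\to\operatorname{End}(V)$. For $\mathcal R\in\otimes^2V^*\otimes\operatorname{End}(V)$ put $\rho_{14}(\mathcal R)(x,y)=\operatorname{Tr}\{z\mapsto\mathcal R(z,x)y\}$ and $\rho_{34}(\mathcal R)(x,y)=\operatorname{Tr}\{z\mapsto\mathcal R(x,y)z\}$. Let $\mathfrak F(V)\subset\otimes^2V^*\otimes\operatorname{End}(V)$ be the space of affine curvature operators, i.e. of those $\mathcal F$ such that, for all $x,y,z\in V$, $$\mathcal F(x,y)z=-\mathcal F(y,x)z,\qquad \mathcal F(x,y)z+\mathcal F(y,z)x+\mathcal F(z,x)y=0,$$ $$\rho_{14}(\mathcal F)(x,y)=\rho_{14}(\mathcal F)(y,x),\qquad \rho_{34}(\mathcal F)=0.$$ Let $\sigma:S^2(V^*)\to\mathfrak F(V)$ be the linear map $$\sigma(\psi)(x,y)z=\tfrac1{1-m}\{\psi(x,z)y-\psi(y,z)x\},$$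 which satisfies $\rho_{14}(\sigma(\psi))=\psi$; its image $\sigma(S^2(V^*))$ is the $S^2(V^*)$-summand of $\mathfrak F(V)$ (a complement of $\ker\rho_{14}\cap\mathfrak F(V)$). **Theorem 4.3.** (1) For $h\in S^2(V^*)$ define $\mathcal R_h(x,y)z=h(y,z)x-h(x,z)y$. Then $\mathcal R_h\in\sigma(S^2(V^*))$ for every $h\in S^2(V^*)$, and $$\sigma(S^2(V^*))=\operatorname{Span}_{h\in S^2(V^*)}\{\mathcal R_h\}.$$ (2) For $\mathcal C\in S^2(V^*)\otimes V$ define $\mathcal R_{\mathcal C}(w,v)u=\mathcal C(v,\mathcal C(w,u))-\mathcal C(w,\mathcal C(v,u))$. Then $\mathcal R_{\mathcal C}\in\mathfrak F(V)$ for every $\mathcal C\in S^2(V^*)\otimes V$, and $$\mathfrak F(V)=\operatorname{Span}_{\mathcal C\in S^2(V^*)\otimes V}\{\mathcal R_{\mathcal C}\}.$$ -/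

import Mathlib

namespace AffineCurvature

variable (V : Type*) [AddCommGroup V] [Module ℝ V]

/-- The space `⊗² V* ⊗ End(V)`, realised as the space of `End(V)`-valued bilinear maps
`(x, y) ↦ 𝓡(x, y)`. -/
abbrev OpTensor : Type _ := V →ₗ[ℝ] V →ₗ[ℝ] Module.End ℝ V

/-- The symmetric bilinear maps `V × V → W`. For `W = ℝ` this is `S²(V*)`, and for `W = V` (with `V`
finite dimensional) it is `S²(V*) ⊗ V`. -/
def symBilin (W : Type*) [AddCommGroup W] [Module ℝ W] : Submodule ℝ (V →ₗ[ℝ] V →ₗ[ℝ] W) where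
  carrier := {B | ∀ x y, B x y = B y x}
  zero_mem' := fun _ _ => rfl
  add_mem' := fun {A B} hA hB x y => by simp [hA x y, hB x y]
  smul_mem' := fun c B hB x y => by simp [hB x y]

/-- `S²(V*)`, the symmetric bilinear forms on `V`. -/
abbrev S2 : Submodule ℝ (V →ₗ[ℝ] V →ₗ[ℝ] ℝ) := symBilin V ℝ

/-- `S²(V*) ⊗ V`, the symmetric bilinear maps `V × V → V`. -/
abbrev S2V : Submodule ℝ (V →ₗ[ℝ] V →ₗ[ℝ] V) := symBilin V V

variable {V}

/-- The trace `ρ₁₄(𝓡)(x, y) = Tr {z ↦ 𝓡(z, x) y}`. -/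
noncomputable def rho14 (R : OpTensor V) : V →ₗ[ℝ] V →ₗ[ℝ] ℝ :=
  LinearMap.mk₂ ℝ (fun x y => LinearMap.trace ℝ V ((R.flip x).flip y))
    (fun x₁ x₂ y => by rw [← map_add]; congr 1; ext z; simp)
    (fun c x y => by rw [← map_smul]; congr 1; ext z; simp)
    (fun x y₁ y₂ => by rw [← map_add]; congr 1; ext z; simp)
    (fun c x y => by rw [← map_smul]; congr 1; ext z; simp)

/-- The trace `ρ₃₄(𝓡)(x, y) = Tr {z ↦ 𝓡(x, y) z}`. -/
noncomputable def rho34 (R : OpTensor V) : V →ₗ[ℝ] V →ₗ[ℝ] ℝ :=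
  R.compr₂ (LinearMap.trace ℝ V)

variable (V)

/-- The space `𝔉(V)` of affine curvature operators: antisymmetry, the first Bianchi identity,
symmetry of `ρ₁₄`, and vanishing of `ρ₃₄`. -/
def affineCurv : Submodule ℝ (OpTensor V) where
  carrier := {F | (∀ x y z, F x y z = -F y x z) ∧
    (∀ x y z, F x y z + F y z x + F z x y = 0) ∧
    (∀ x y, rho14 F x y = rho14 F y x) ∧
    rho34 F = 0}
  zero_mem' := by
    refine ⟨by simp, by simp, fun x y => ?_, ?_⟩
    · have h : ∀ a b : V, ((0 : OpTensor V).flip a).flip b = 0 := fun a b => by ext; simp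
      simp [rho14, h]
    · ext; simp [rho34]
  add_mem' := by
    rintro A B ⟨a1, a2, a3, a4⟩ ⟨b1, b2, b3, b4⟩
    have h : ∀ a b : V, rho14 (A + B) a b = rho14 A a b + rho14 B a b := fun a b => by
      simp only [rho14, LinearMap.mk₂_apply, ← map_add]; congr 1
    refine ⟨fun x y z => ?_, fun x y z => ?_, fun x y => ?_, ?_⟩
    · simp only [LinearMap.add_apply, a1 x y z, b1 x y z]; abel
    · have := congrArg₂ (· + ·) (a2 x y z) (b2 x y z)
      simp only [LinearMap.add_apply, add_zero] at this ⊢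
      rw [← this]; abel
    · rw [h, h, a3, b3]
    · have : rho34 (A + B) = rho34 A + rho34 B := by ext; simp [rho34]
      rw [this, a4, b4, add_zero]
  smul_mem' := by
    rintro c A ⟨a1, a2, a3, a4⟩
    have h : ∀ a b : V, rho14 (c • A) a b = c * rho14 A a b := fun a b => by
      simp only [rho14, LinearMap.mk₂_apply]; rw [← smul_eq_mul, ← LinearMap.map_smul]; congr 1
    refine ⟨fun x y z => ?_, fun x y z => ?_, fun x y => ?_, ?_⟩
    · simp only [LinearMap.smul_apply, a1 x y z, smul_neg]
    · simp only [LinearMap.smul_apply, ← smul_add, a2, smul_zero]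
    · rw [h, h, a3]
    · have : rho34 (c • A) = c • rho34 A := by ext; simp [rho34]
      rw [this, a4, smul_zero]

variable {V}

/-- `𝓡_h(x, y) z = h(y, z) x - h(x, z) y`. -/
def opOfForm (h : V →ₗ[ℝ] V →ₗ[ℝ] ℝ) : OpTensor V :=
  LinearMap.mk₂ ℝ (fun x y => (h y).smulRight x - (h x).smulRight y)
    (fun x₁ x₂ y => by ext z; simp [add_smul]; abel)
    (fun c x y => by ext z; simp [smul_sub, mul_smul, smul_comm c])
    (fun x y₁ y₂ => by ext z; simp [add_smul]; abel)
    (fun c x y => by ext z; simp [smul_sub, mul_smul, smul_comm c])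

/-- `𝓡_𝓒(w, v) u = 𝓒(v, 𝓒(w, u)) - 𝓒(w, 𝓒(v, u))`. -/
def opOfSymMap (C : V →ₗ[ℝ] V →ₗ[ℝ] V) : OpTensor V :=
  LinearMap.mk₂ ℝ (fun w v => C v ∘ₗ C w - C w ∘ₗ C v)
    (fun w₁ w₂ v => by ext u; simp; abel)
    (fun c w v => by ext u; simp [smul_sub])
    (fun w v₁ v₂ => by ext u; simp; abel)
    (fun c w v => by ext u; simp [smul_sub])

variable (V)

/-- The splitting `σ : S²(V*) → 𝔉(V)` of the trace `ρ₁₄`, where `m = dim V`: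
`σ(ψ)(x, y) z = (1 / (1 - m)) (ψ(x, z) y - ψ(y, z) x)`. -/
noncomputable def sigmaS : S2 V →ₗ[ℝ] OpTensor V where
  toFun ψ := LinearMap.mk₂ ℝ
    (fun x y => (1 / (1 - (Module.finrank ℝ V : ℝ))) •
      ((ψ.1 x).smulRight y - (ψ.1 y).smulRight x))
    (fun x₁ x₂ y => by rw [← smul_add]; congr 1; ext z; simp [add_smul]; abel)
    (fun c x y => by rw [smul_comm c]; congr 1; ext z; simp [smul_sub, mul_smul, smul_comm c])
    (fun x y₁ y₂ => by rw [← smul_add]; congr 1; ext z; simp [add_smul]; abel)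
    (fun c x y => by rw [smul_comm c]; congr 1; ext z; simp [smul_sub, mul_smul, smul_comm c])
  map_add' := fun ψ φ => by
    ext x y z
    simp only [LinearMap.mk₂_apply, LinearMap.add_apply, Submodule.coe_add, LinearMap.smul_apply,
      LinearMap.sub_apply, LinearMap.smulRight_apply, add_smul, ← smul_add]
    congr 1; abel
  map_smul' := fun c ψ => by
    ext x y z
    simp only [LinearMap.mk₂_apply, Submodule.coe_smul, LinearMap.smul_apply,
      LinearMap.sub_apply, LinearMap.smulRight_apply, RingHom.id_apply, smul_eq_mul, mul_smul,
      smul_sub, smul_comm c]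

/-- The `S²(V*)`-summand `σ(S²(V*))` of `𝔉(V) = 𝔘(V) ⊕ σ(S²(V*))`, where `𝔘(V)` is the kernel
of `ρ₁₄` on `𝔉(V)`. -/
noncomputable def symSummand : Submodule ℝ (OpTensor V) := LinearMap.range (sigmaS V)

variable {V}

theorem sigmaS_apply (ψ : S2 V) (x y z : V) : sigmaS V ψ x y z =
    (1 / (1 - (Module.finrank ℝ V : ℝ))) • (ψ.1 x z • y - ψ.1 y z • x) := rfl

/-- `σ` is a section of `ρ₁₄`. -/
theorem rho14_sigmaS [FiniteDimensional ℝ V] (hV : 2 ≤ Module.finrank ℝ V) (ψ : S2 V) :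
    rho14 (sigmaS V ψ) = ψ.1 := by
  have hm : (1 - (Module.finrank ℝ V : ℝ)) ≠ 0 := by
    have : (2 : ℝ) ≤ Module.finrank ℝ V := by exact_mod_cast hV
    linarith
  ext x y
  have h : ((sigmaS V ψ).flip x).flip y = (1 / (1 - (Module.finrank ℝ V : ℝ))) •
      ((ψ.1 y).smulRight x - (ψ.1 x y) • LinearMap.id) := by
    ext z
    simp [sigmaS_apply, ψ.2 z y]
  have ht : LinearMap.trace ℝ V ((ψ.1 y).smulRight x) = ψ.1 y x := by
    simp [LinearMap.trace_smulRight]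
  simp only [rho14, LinearMap.mk₂_apply, h, map_smul, map_sub, ht, LinearMap.trace_id, smul_eq_mul,
    ψ.2 y x]
  field_simp

/-- `σ` takes values in `𝔉(V)`. -/
theorem sigmaS_mem [FiniteDimensional ℝ V] (hV : 2 ≤ Module.finrank ℝ V) (ψ : S2 V) :
    sigmaS V ψ ∈ affineCurv V := by
  refine ⟨fun x y z => ?_, fun x y z => ?_, fun x y => ?_, ?_⟩
  · rw [sigmaS_apply, sigmaS_apply, ← smul_neg, neg_sub]
  · rw [sigmaS_apply, sigmaS_apply, sigmaS_apply, ← smul_add, ← smul_add, ψ.2 y x, ψ.2 z x,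
      ψ.2 z y]
    convert smul_zero _ using 2
    abel
  · rw [rho14_sigmaS hV, ψ.2 x y]
  · ext x y
    have h : sigmaS V ψ x y = (1 / (1 - (Module.finrank ℝ V : ℝ))) •
      ((ψ.1 x).smulRight y - (ψ.1 y).smulRight x) := rfl
    have ht : ∀ (f : V →ₗ[ℝ] ℝ) (v : V), LinearMap.trace ℝ V (f.smulRight v) = f v := by
      simp [LinearMap.trace_smulRight]
    simp [rho34, h, ht, ψ.2 x y]

end AffineCurvature

/-!
The map `𝓒 ↦ 𝓡_𝓒` is quadratic, so the span of its values contains its polarizations. Polarizing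
at the symmetric product of a linear form with the identity gives the operators `𝓡_h`. Tracing the
polarizations at `symProd α (eⁱ ⊗ a)` and `q ⊗ eᵢ` over `i` shows that for every linear map
`E : V → S²(V*) ⊗ V` the span contains the operator `(w, v) ↦ (m + 1) (E(v, w) - E(w, v))` up to
terms built from `τ = ρ₃₄(E)`; when `τ` is symmetric these reduce to `𝓡_τ`, hence
`(w, v) ↦ E(v, w) - E(w, v)` lies in the span. For `F ∈ 𝔉(V)` the choice
`E(v, w) u = F(w, v) u + F(u, v) w` gives `3 F` by the first Bianchi identity, and there
`τ = ρ₁₄(F)` is symmetric because `ρ₃₄(F) = 0`.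
-/

namespace AffineCurvature

variable {V W : Type*} [AddCommGroup V] [Module ℝ V] [AddCommGroup W] [Module ℝ W]

theorem rho14_apply (R : OpTensor V) (x y : V) :
    rho14 R x y = LinearMap.trace ℝ V ((R.flip x).flip y) := rfl

theorem rho34_apply (R : OpTensor V) (x y : V) : rho34 R x y = LinearMap.trace ℝ V (R x y) := rfl

theorem opOfForm_apply (h : V →ₗ[ℝ] V →ₗ[ℝ] ℝ) (x y z : V) :
    opOfForm h x y z = h y z • x - h x z • y := rfl

theorem opOfSymMap_apply (C : V →ₗ[ℝ] V →ₗ[ℝ] V) (w v u : V) :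
    opOfSymMap C w v u = C v (C w u) - C w (C v u) := rfl

theorem sigmaS_eq_smul_opOfForm (ψ : S2 V) :
    sigmaS V ψ = (1 / ((Module.finrank ℝ V : ℝ) - 1)) • opOfForm ψ.1 := by
  ext x y z
  simp only [sigmaS_apply, LinearMap.smul_apply, opOfForm_apply]
  rw [← neg_sub (Module.finrank ℝ V : ℝ) 1, one_div_neg_eq_neg_one_div]
  module

theorem symSummand_eq_span_opOfForm (hV : Module.finrank ℝ V ≠ 1) :
    symSummand V = Submodule.span ℝ {R | ∃ h ∈ S2 V, R = opOfForm h} := by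
  refine le_antisymm ?_ (Submodule.span_le.2 ?_)
  · rintro _ ⟨ψ, rfl⟩
    rw [sigmaS_eq_smul_opOfForm]
    exact Submodule.smul_mem _ _ (Submodule.subset_span ⟨ψ.1, ψ.2, rfl⟩)
  · rintro _ ⟨h, hh, rfl⟩
    have hm : (Module.finrank ℝ V : ℝ) - 1 ≠ 0 := sub_ne_zero.2 (by exact_mod_cast hV)
    refine ⟨((Module.finrank ℝ V : ℝ) - 1) • ⟨h, hh⟩, ?_⟩
    rw [map_smul, sigmaS_eq_smul_opOfForm, smul_smul, mul_one_div_cancel hm, one_smul]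

theorem rho14_opOfSymMap {C : V →ₗ[ℝ] V →ₗ[ℝ] V} (hC : C ∈ S2V V) (x y : V) :
    rho14 (opOfSymMap C) x y =
      LinearMap.trace ℝ V (C x * C y) - LinearMap.trace ℝ V (C (C x y)) := by
  rw [rho14_apply, ← map_sub]
  congr 1
  ext z
  simp only [LinearMap.flip_apply, opOfSymMap_apply, LinearMap.sub_apply, Module.End.mul_apply]
  rw [hC z y, hC z (C x y)]

theorem rho34_opOfSymMap (C : V →ₗ[ℝ] V →ₗ[ℝ] V) : rho34 (opOfSymMap C) = 0 := by
  ext x y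
  change LinearMap.trace ℝ V (C y * C x - C x * C y) = 0
  rw [map_sub, LinearMap.trace_mul_comm, sub_self]

theorem opOfSymMap_mem_affineCurv {C : V →ₗ[ℝ] V →ₗ[ℝ] V} (hC : C ∈ S2V V) :
    opOfSymMap C ∈ affineCurv V := by
  refine ⟨fun x y z => ?_, fun x y z => ?_, fun x y => ?_, rho34_opOfSymMap C⟩
  · rw [opOfSymMap_apply, opOfSymMap_apply, neg_sub]
  · simp only [opOfSymMap_apply]
    rw [hC y x, hC z x, hC z y]
    abel
  · rw [rho14_opOfSymMap hC, rho14_opOfSymMap hC, LinearMap.trace_mul_comm, hC x y]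

variable (V) in
/-- The span of the operators `𝓡_𝓒`, for `𝓒` a symmetric bilinear map `V × V → V`. -/
def symMapSpan : Submodule ℝ (OpTensor V) :=
  Submodule.span ℝ {R | ∃ C ∈ S2V V, R = opOfSymMap C}

theorem polar_opOfSymMap_apply (C D : V →ₗ[ℝ] V →ₗ[ℝ] V) (w v u : V) :
    QuadraticMap.polar opOfSymMap C D w v u =
      C v (D w u) + D v (C w u) - (C w (D v u) + D w (C v u)) := by
  simp only [QuadraticMap.polar, LinearMap.sub_apply, opOfSymMap_apply, LinearMap.add_apply,
    map_add]
  abel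

theorem polar_opOfSymMap_mem_symMapSpan {C D : V →ₗ[ℝ] V →ₗ[ℝ] V} (hC : C ∈ S2V V)
    (hD : D ∈ S2V V) : QuadraticMap.polar opOfSymMap C D ∈ symMapSpan V := by
  have mem {B : V →ₗ[ℝ] V →ₗ[ℝ] V} (hB : B ∈ S2V V) : opOfSymMap B ∈ symMapSpan V :=
    Submodule.subset_span ⟨B, hB, rfl⟩
  exact Submodule.sub_mem (M := OpTensor V) _
    (Submodule.sub_mem (M := OpTensor V) _ (mem (add_mem hC hD)) (mem hC)) (mem hD)

/-- The symmetric product of a linear form `α` and a linear map `f`, namely the symmetric bilinear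
map `(x, y) ↦ α(x) f(y) + α(y) f(x)`. -/
def symProd (α : V →ₗ[ℝ] ℝ) (f : V →ₗ[ℝ] W) : V →ₗ[ℝ] V →ₗ[ℝ] W :=
  α.smulRight f + (α.smulRight f).flip

theorem symProd_apply (α : V →ₗ[ℝ] ℝ) (f : V →ₗ[ℝ] W) (x y : V) :
    symProd α f x y = α x • f y + α y • f x := rfl

theorem symProd_mem_symBilin (α : V →ₗ[ℝ] ℝ) (f : V →ₗ[ℝ] W) : symProd α f ∈ symBilin V W :=
  fun _ _ => add_comm _ _

/-- The tensor `q ⊗ a` of a bilinear form and a vector, as the bilinear map `(x, y) ↦ q(x, y) a`. -/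
def formTmul (q : V →ₗ[ℝ] V →ₗ[ℝ] ℝ) (a : W) : V →ₗ[ℝ] V →ₗ[ℝ] W :=
  q.compr₂ (LinearMap.toSpanSingleton ℝ W a)

theorem formTmul_apply (q : V →ₗ[ℝ] V →ₗ[ℝ] ℝ) (a : W) (x y : V) :
    formTmul q a x y = q x y • a := rfl

theorem formTmul_mem_symBilin {q : V →ₗ[ℝ] V →ₗ[ℝ] ℝ} (hq : q ∈ S2 V) (a : W) :
    formTmul q a ∈ symBilin V W :=
  fun x y => by rw [formTmul_apply, formTmul_apply, hq x y]

theorem polar_opOfSymMap_symProd_id (α : V →ₗ[ℝ] ℝ) {D : V →ₗ[ℝ] V →ₗ[ℝ] V} (hD : D ∈ S2V V) :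
    QuadraticMap.polar opOfSymMap (symProd α LinearMap.id) D = -opOfForm (D.compr₂ α) := by
  ext w v u
  simp only [polar_opOfSymMap_apply, symProd_apply, LinearMap.id_apply, LinearMap.neg_apply,
    opOfForm_apply, LinearMap.compr₂_apply, map_add, map_smul, hD w v]
  module

theorem opOfForm_mem_symMapSpan {h : V →ₗ[ℝ] V →ₗ[ℝ] ℝ} (hh : h ∈ S2 V) :
    opOfForm h ∈ symMapSpan V := by
  rcases subsingleton_or_nontrivial V with _ | _
  · rw [Subsingleton.elim (opOfForm h) 0]
    exact zero_mem _
  obtain ⟨e, he⟩ := exists_ne (0 : V)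
  obtain ⟨α, hα⟩ := Module.Projective.exists_dual_eq_one ℝ he
  have h_eq : (formTmul h e).compr₂ α = h := by
    ext x y
    simp [formTmul_apply, hα]
  have hD : formTmul h e ∈ S2V V := formTmul_mem_symBilin hh e
  rw [← h_eq, ← Submodule.neg_mem_iff (M := OpTensor V), ← polar_opOfSymMap_symProd_id α hD]
  exact polar_opOfSymMap_mem_symMapSpan (symProd_mem_symBilin α _) hD

/-- The linear map sending `E` to the operator
`(w, v) ↦ (m + 1) (E(v, w) - E(w, v)) + opOfForm τᵗ (w, v) + (τ(w, v) - τ(v, w)) id`, with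
`m = dim V` and `τ = ρ₃₄(E)`. It sends a decomposable `E = α ⊗ q ⊗ a` to the trace over `i` of
the polarizations of `𝓒 ↦ 𝓡_𝓒` at `symProd α (eⁱ ⊗ a)` and `q ⊗ eᵢ`. -/
noncomputable def tracedPolar : OpTensor V →ₗ[ℝ] OpTensor V where
  toFun E := (Module.finrank ℝ V + 1 : ℝ) • (E.flip - E) + opOfForm (rho34 E).flip +
    formTmul (rho34 E - (rho34 E).flip) LinearMap.id
  map_add' E E' := by
    ext w v u
    simp only [LinearMap.add_apply, LinearMap.smul_apply, LinearMap.sub_apply,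
      LinearMap.flip_apply, formTmul_apply, rho34_apply, opOfForm_apply, LinearMap.id_apply,
      map_add]
    module
  map_smul' c E := by
    ext w v u
    simp only [LinearMap.add_apply, LinearMap.smul_apply, LinearMap.sub_apply,
      LinearMap.flip_apply, formTmul_apply, rho34_apply, opOfForm_apply, LinearMap.id_apply,
      map_smul, smul_eq_mul, RingHom.id_apply]
    module

theorem tracedPolar_apply (E : OpTensor V) :
    tracedPolar E = (Module.finrank ℝ V + 1 : ℝ) • (E.flip - E) + opOfForm (rho34 E).flip +
      formTmul (rho34 E - (rho34 E).flip) LinearMap.id := rfl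

theorem rho34_smulRight_formTmul [FiniteDimensional ℝ V] (α : V →ₗ[ℝ] ℝ)
    (q : V →ₗ[ℝ] V →ₗ[ℝ] ℝ) (a x y : V) :
    rho34 (α.smulRight (formTmul q a)) x y = α x * q y a := by
  change LinearMap.trace ℝ V (α x • (q y).smulRight a) = α x * q y a
  rw [map_smul, LinearMap.trace_smulRight, smul_eq_mul]

section Basis

variable {ι : Type*} [Fintype ι] (b : Module.Basis ι ℝ V)

theorem sum_coord_smul_apply (f : V →ₗ[ℝ] W) (v : V) : ∑ i, b.coord i v • f (b i) = f v := by
  conv_rhs => rw [← b.sum_repr v, map_sum]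
  simp

theorem sum_smulRight_formTmul (E : V →ₗ[ℝ] V →ₗ[ℝ] V →ₗ[ℝ] V) :
    ∑ j, ∑ k, (b.coord j).smulRight (formTmul ((E (b j)).compr₂ (b.coord k)) (b k)) = E := by
  ext x y z
  have hk (j : ι) : ∑ k, b.coord k (E (b j) y z) • b k = E (b j) y z :=
    sum_coord_smul_apply b LinearMap.id _
  simp only [LinearMap.sum_apply, LinearMap.smulRight_apply, LinearMap.smul_apply, formTmul_apply,
    LinearMap.compr₂_apply, ← Finset.smul_sum, hk]
  exact sum_coord_smul_apply b ((E.flip y).flip z) x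

theorem sum_symProd_apply_formTmul (α : V →ₗ[ℝ] ℝ) (q : V →ₗ[ℝ] V →ₗ[ℝ] ℝ) (a v w u : V) :
    ∑ i, symProd α ((b.coord i).smulRight a) v (formTmul q (b i) w u) =
      ((Fintype.card ι + 1 : ℝ) * α v * q w u) • a := by
  have hcard : ∑ i, b.coord i (b i) = (Fintype.card ι : ℝ) := by simp
  have hα : ∑ i, b.coord i v * α (b i) = α v := sum_coord_smul_apply b α v
  calc ∑ i, symProd α ((b.coord i).smulRight a) v (formTmul q (b i) w u)
      = ∑ i, (q w u * (α v * b.coord i (b i) + b.coord i v * α (b i))) • a := by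
        refine Finset.sum_congr rfl fun i _ => ?_
        simp only [symProd_apply, formTmul_apply, LinearMap.smulRight_apply, map_smul]
        module
    _ = ((Fintype.card ι + 1 : ℝ) * α v * q w u) • a := by
        rw [← Finset.sum_smul, ← Finset.mul_sum, Finset.sum_add_distrib, ← Finset.mul_sum, hcard,
          hα]
        congr 1
        ring

theorem sum_formTmul_apply_symProd (α : V →ₗ[ℝ] ℝ) (q : V →ₗ[ℝ] V →ₗ[ℝ] ℝ) (a v w u : V) :
    ∑ i, formTmul q (b i) v (symProd α ((b.coord i).smulRight a) w u) =
      q v a • (α w • u + α u • w) := by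
  have hb (x : V) : ∑ i, b.coord i x • b i = x := sum_coord_smul_apply b LinearMap.id x
  calc ∑ i, formTmul q (b i) v (symProd α ((b.coord i).smulRight a) w u)
      = ∑ i, q v a • (α w • b.coord i u • b i + α u • b.coord i w • b i) := by
        refine Finset.sum_congr rfl fun i _ => ?_
        simp only [symProd_apply, formTmul_apply, LinearMap.smulRight_apply, map_add, map_smul]
        module
    _ = q v a • (α w • u + α u • w) := by
        rw [← Finset.smul_sum, Finset.sum_add_distrib, ← Finset.smul_sum, ← Finset.smul_sum, hb,
          hb]

theorem sum_polar_opOfSymMap_symProd_formTmul (α : V →ₗ[ℝ] ℝ) (q : V →ₗ[ℝ] V →ₗ[ℝ] ℝ) (a : V) :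
    ∑ i, QuadraticMap.polar opOfSymMap (symProd α ((b.coord i).smulRight a)) (formTmul q (b i)) =
      tracedPolar (α.smulRight (formTmul q a)) := by
  have : FiniteDimensional ℝ V := Module.Finite.of_basis b
  ext w v u
  simp only [LinearMap.sum_apply, polar_opOfSymMap_apply, Finset.sum_sub_distrib,
    Finset.sum_add_distrib, sum_symProd_apply_formTmul, sum_formTmul_apply_symProd]
  simp only [tracedPolar_apply, Module.finrank_eq_card_basis b, LinearMap.add_apply,
    LinearMap.smul_apply, LinearMap.sub_apply, LinearMap.flip_apply, LinearMap.smulRight_apply,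
    formTmul_apply, opOfForm_apply, rho34_smulRight_formTmul, LinearMap.id_apply]
  module

end Basis

/-- The operator `E(v, w) u = F(w, v) u + F(u, v) w`, the symmetrization of `F(w, v) u` in `w`
and `u`. -/
def symmetrization (F : OpTensor V) : OpTensor V :=
  F.flip + LinearMap.lflip.comp F.flip

theorem symmetrization_apply (F : OpTensor V) (v w u : V) :
    symmetrization F v w u = F w v u + F u v w := rfl

theorem symmetrization_mem_S2V (F : OpTensor V) (v : V) : symmetrization F v ∈ S2V V :=
  fun _ _ => add_comm _ _

theorem rho34_symmetrization (F : OpTensor V) :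
    rho34 (symmetrization F) = (rho34 F).flip + rho14 F := by
  ext x y
  rw [LinearMap.add_apply, LinearMap.add_apply, LinearMap.flip_apply, rho34_apply, rho34_apply,
    rho14_apply, ← map_add]
  rfl

theorem symmetrization_flip_sub_self {F : OpTensor V} (hF : F ∈ affineCurv V) :
    (symmetrization F).flip - symmetrization F = (3 : ℝ) • F := by
  obtain ⟨anti, bianchi, -, -⟩ := hF
  ext w v u
  have hbianchi : F u v w + F w u v = F w v u := by
    rw [anti u v w, anti w u v, ← neg_add, neg_eq_iff_add_eq_zero, add_comm, ← bianchi w v u]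
    abel
  simp only [LinearMap.sub_apply, LinearMap.flip_apply, LinearMap.smul_apply, symmetrization_apply]
  rw [anti v w u, anti u w v, ← hbianchi]
  module

section FiniteDimensional

variable [FiniteDimensional ℝ V]

theorem tracedPolar_mem_symMapSpan {E : OpTensor V} (hE : ∀ v, E v ∈ S2V V) :
    tracedPolar E ∈ symMapSpan V := by
  let b := Module.finBasis ℝ V
  rw [← sum_smulRight_formTmul b E]
  simp only [map_sum, ← sum_polar_opOfSymMap_symProd_formTmul b]
  refine Submodule.sum_mem _ fun j _ => Submodule.sum_mem _ fun k _ => Submodule.sum_mem _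
    fun i _ => polar_opOfSymMap_mem_symMapSpan (symProd_mem_symBilin _ _)
      (formTmul_mem_symBilin ?_ _)
  exact fun x y => congrArg (b.coord k) (hE (b j) x y)

theorem flip_sub_mem_symMapSpan {E : OpTensor V} (hE : ∀ v, E v ∈ S2V V)
    (hτ : rho34 E ∈ S2 V) : E.flip - E ∈ symMapSpan V := by
  have hflip : (rho34 E).flip = rho34 E := LinearMap.ext₂ fun x y => hτ y x
  have h_eq : (Module.finrank ℝ V + 1 : ℝ) • (E.flip - E) =
      tracedPolar E - opOfForm (rho34 E) := by
    ext
    simp [tracedPolar_apply, hflip, formTmul_apply]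
  have h_mem : (Module.finrank ℝ V + 1 : ℝ) • (E.flip - E) ∈ symMapSpan V := by
    rw [h_eq]
    exact Submodule.sub_mem (M := OpTensor V) _ (tracedPolar_mem_symMapSpan hE)
      (opOfForm_mem_symMapSpan hτ)
  exact (Submodule.smul_mem_iff _ (by positivity)).1 h_mem

theorem affineCurv_eq_symMapSpan : affineCurv V = symMapSpan V := by
  refine le_antisymm (fun F hF => ?_) (Submodule.span_le.2 ?_)
  · have hτ : rho34 (symmetrization F) ∈ S2 V := by
      obtain ⟨-, -, sym, tr⟩ := hF
      intro x y
      simpa [rho34_symmetrization, tr] using sym x y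
    have h_mem := flip_sub_mem_symMapSpan (symmetrization_mem_S2V F) hτ
    rw [symmetrization_flip_sub_self hF] at h_mem
    exact (Submodule.smul_mem_iff _ three_ne_zero).1 h_mem
  · rintro _ ⟨C, hC, rfl⟩
    exact opOfSymMap_mem_affineCurv hC

end FiniteDimensional

end AffineCurvature

theorem theorem4p3_general {V : Type*} [AddCommGroup V] [Module ℝ V] [FiniteDimensional ℝ V]
    (hV : Module.finrank ℝ V ≠ 1) :
    ((∀ h ∈ AffineCurvature.S2 V,
        AffineCurvature.opOfForm h ∈ AffineCurvature.symSummand V) ∧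
      AffineCurvature.symSummand V =
        Submodule.span ℝ {R | ∃ h ∈ AffineCurvature.S2 V, R = AffineCurvature.opOfForm h}) ∧
    ((∀ C ∈ AffineCurvature.S2V V,
        AffineCurvature.opOfSymMap C ∈ AffineCurvature.affineCurv V) ∧
      AffineCurvature.affineCurv V =
        Submodule.span ℝ {R | ∃ C ∈ AffineCurvature.S2V V, R = AffineCurvature.opOfSymMap C}) := by
  have h_form := AffineCurvature.symSummand_eq_span_opOfForm hV
  refine ⟨⟨fun h hh => ?_, h_form⟩, fun C hC => AffineCurvature.opOfSymMap_mem_affineCurv hC,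
    AffineCurvature.affineCurv_eq_symMapSpan⟩
  rw [h_form]
  exact Submodule.subset_span ⟨h, hh, rfl⟩

theorem theorem4p3 {V : Type*} [AddCommGroup V] [Module ℝ V] [FiniteDimensional ℝ V]
    (hV : 4 ≤ Module.finrank ℝ V) :
    ((∀ h ∈ AffineCurvature.S2 V,
        AffineCurvature.opOfForm h ∈ AffineCurvature.symSummand V) ∧
      AffineCurvature.symSummand V =
        Submodule.span ℝ {R | ∃ h ∈ AffineCurvature.S2 V, R = AffineCurvature.opOfForm h}) ∧
    ((∀ C ∈ AffineCurvature.S2V V,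
        AffineCurvature.opOfSymMap C ∈ AffineCurvature.affineCurv V) ∧
      AffineCurvature.affineCurv V =
        Submodule.span ℝ {R | ∃ C ∈ AffineCurvature.S2V V, R = AffineCurvature.opOfSymMap C}) :=
  theorem4p3_general (by omega)
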